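/- Let $H$ be the 3-uniform hypergraph with five distinct vertices $v_0,v_1,v_2,v_3,v_4$ and hyperedges $E_1=\{v_0,v_1,v_2\}$, $E_2=\{v_1,v_2,v_3\}$, $E_3=\{v_3,v_4,v_0\}$ (a cycle of length 3), and let each vertex $v_i$ carry a positive integer weight $g_i$. Let $PW(H)=\max\{g_0g_1g_2,\;g_1g_2g_3,\;g_3g_4g_0\}$ be the product weight of $H$, and put $n=PW(H)$. Suppose that $$g_0g_1g_2=PW(H),\qquad g_0\equiv 0 \pmod{g_3},\qquad g_3\le\min\{g_0,\max\{g_1,g_2\}\}.$$ Then there is a balanced $3\text{-}CA(n,H,\prod_{i=0}^{4}g_i)$, that is, a $5\times n$ array with rows indexed by the vertices, the row of $v_i$ having entries in $\mathbb{Z}_{g_i}$, such that 1. (covering) for every hyperedge $\{v_i,v_j,v_k\}$ of $H$ and every $(a,b,c)\in\mathbb{Z}_{g_i}\times\mathbb{Z}_{g_j}\times\mathbb{Z}_{g_k}$, some column has the entries $a,b,c$ in the rows of $v_i,v_j,v_k$; 2. (balanced rows) in the row of each $v_i$ every symbol of $\mathbb{Z}_{g_i}$ occurs $\lfloor n/g_i\rfloor$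 or $\lceil n/g_i\rceil$ times; 3. (pairwise balanced rows) for any two distinct vertices $v_i,v_j$ in a common hyperedge, every pair $(a,b)\in\mathbb{Z}_{g_i}\times\mathbb{Z}_{g_j}$ occurs in the rows of $v_i,v_j$ in $\lfloor n/(g_ig_j)\rfloor$ or $\lceil n/(g_ig_j)\rceil$ columns. -/

import Mathlib

/-- A length-`n` vector over the alphabet `ZMod g` is balanced if every symbol occurs
`⌊n / g⌋` or `⌈n / g⌉` times. -/
def IsBalancedVector {n g : ℕ} (x : Fin n → ZMod g) : Prop :=
  ∀ a : ZMod g,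
    {j : Fin n | x j = a}.ncard = ⌊(n : ℚ) / g⌋₊ ∨ {j : Fin n | x j = a}.ncard = ⌈(n : ℚ) / g⌉₊

/-- Two length-`n` vectors are pairwise balanced if both are balanced and every pair of symbols
occurs `⌊n / (g₁ g₂)⌋` or `⌈n / (g₁ g₂)⌉` times. -/
def IsPairwiseBalanced {n g₁ g₂ : ℕ} (x : Fin n → ZMod g₁) (y : Fin n → ZMod g₂) : Prop :=
  IsBalancedVector x ∧ IsBalancedVector y ∧
    ∀ (a : ZMod g₁) (b : ZMod g₂),
      {j : Fin n | x j = a ∧ y j = b}.ncard = ⌊(n : ℚ) / (g₁ * g₂)⌋₊ ∨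
      {j : Fin n | x j = a ∧ y j = b}.ncard = ⌈(n : ℚ) / (g₁ * g₂)⌉₊

/-- The product weight of a 3-uniform hypergraph with vertex weights `w`: the maximum of
`w u * w v * w x` over its hyperedges `{u, v, x}`. -/
noncomputable def productWeight {α : Type*} (H : Hypergraph α) (w : α → ℕ) : ℕ :=
  sSup {p : ℕ | ∃ u v x : α, u ≠ v ∧ u ≠ x ∧ v ≠ x ∧
    ({u, v, x} : Set α) ∈ H.edgeSet ∧ p = w u * w v * w x}

/-- The array `C`, with one row of length `n` over `ZMod (w v)` for each vertex `v` of `H`, is a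
covering array on `H`: for each hyperedge `e`, every choice `s` of one symbol for each vertex of `e`
occurs in some column (symbols `s v` for `v ∉ e` are irrelevant). -/
def IsCoveringArray {α : Type*} (H : Hypergraph α) (w : α → ℕ) {n : ℕ}
    (C : (v : H.vertexSet) → Fin n → ZMod (w v)) : Prop :=
  ∀ e ∈ H.edgeSet, ∀ s : (v : H.vertexSet) → ZMod (w v),
    ∃ j : Fin n, ∀ v : H.vertexSet, (v : α) ∈ e → C v j = s v

/-- A covering array on `H` is balanced if every row is balanced and the rows of any two distinct
vertices lying in a common hyperedge are pairwise balanced. -/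
def IsBalancedCoveringArray {α : Type*} (H : Hypergraph α) (w : α → ℕ) {n : ℕ}
    (C : (v : H.vertexSet) → Fin n → ZMod (w v)) : Prop :=
  IsCoveringArray H w C ∧
  (∀ v : H.vertexSet, IsBalancedVector (C v)) ∧
  ∀ e ∈ H.edgeSet, ∀ u v : H.vertexSet, u ≠ v → (u : α) ∈ e → (v : α) ∈ e →
    IsPairwiseBalanced (C u) (C v)

open Finset

/-! Index the columns by the triples of entries in rows 0, 1, 2, so those rows are coordinates and
the first edge is covered exactly once. Rows 3 and 4 become colourings `y`, `z` of a box. Take `y`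
equitable on the fibres of coordinates (1, 2) and of coordinate 0. As `g₃ ∣ g₀`, the former split
exactly, covering the second edge uniformly. Take `z` equitable on the fibres of (row 0, row 3), of
row 0, of row 3, and on everything. Since `g₃ g₄ ≤ g₁ g₂`, each fibre of (row 0, row 3) has at least
`g₄` points, so the third edge is covered.

Such colourings exist for a chain of partitions plus one more partition (`exists_isEquitableOn`).
With two colours, pair points greedily inside the finest classes, then the coarser ones, and
separately inside the extra partition. The two matchings together form even cycles and paths, so
some 2-colouring splits every pair. For more colours, minimise the sum of squared class sizes:
bisecting the union of two unbalanced colours would lower it. -/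

/-- A colouring `h` is equitable on `A` if the sizes of its colour classes in `A` differ by at most
one. -/
def IsEquitableOn {X κ : Type*} [DecidableEq κ] (A : Finset X) (h : X → κ) : Prop :=
  ∀ s t : κ, #{x ∈ A | h x = s} ≤ #{x ∈ A | h x = t} + 1

/-! ### Alternating 2-colourings and bisections -/

/-- Two fixed-point-free involutions admit a common alternating 2-colouring. -/
theorem exists_alternating_of_forall_ne {X : Type*} (σ τ : Equiv.Perm X)
    (hσ : σ * σ = 1) (hτ : τ * τ = 1) (hσ' : ∀ x, σ x ≠ x) (hτ' : ∀ x, τ x ≠ x) :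
    ∃ χ : X → Bool, ∀ x, χ (σ x) = !χ x ∧ χ (τ x) = !χ x := by
  classical
  set ρ := τ * σ with hρ
  have hσi : σ⁻¹ = σ := inv_eq_of_mul_eq_one_left hσ
  have hτi : τ⁻¹ = τ := inv_eq_of_mul_eq_one_left hτ
  have hρi : ρ⁻¹ = σ * τ := by rw [hρ, mul_inv_rev, hσi, hτi]
  have hconj : ∀ k : ℤ, σ * ρ ^ k = ρ ^ (-k) * σ := by
    intro k
    have h1 : σ * ρ * σ⁻¹ = ρ⁻¹ := by rw [hρi, hσi, hρ, mul_assoc, mul_assoc, hσ, mul_one]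
    have h2 : σ * ρ ^ k * σ⁻¹ = ρ ^ (-k) := by rw [← conj_zpow, h1, inv_zpow, zpow_neg]
    rw [← h2]; group
  -- If `σ x = ρ ^ k x`, the midpoint of this path is fixed by `σ` (`k` even) or by `τ` (`k` odd).
  have hne : ∀ x, ¬ ρ.SameCycle x (σ x) := by
    rintro x ⟨k, hk⟩
    obtain ⟨j, rfl | rfl⟩ := Int.even_or_odd' k
    · apply hσ' ((ρ ^ j) x)
      have h3 : σ * ρ ^ j = ρ ^ (-j) * σ := hconj j
      have : (σ * ρ ^ j) x = (ρ ^ (-j) * ρ ^ (2 * j)) x := by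
        rw [h3, Equiv.Perm.mul_apply, Equiv.Perm.mul_apply, hk]
      rw [← zpow_add] at this
      rw [show -j + 2 * j = j by ring] at this
      exact this
    · apply hτ' ((ρ ^ (j + 1)) x)
      have hτρ : τ = ρ * σ := by rw [hρ, mul_assoc, hσ, mul_one]
      have : (τ * ρ ^ (j + 1)) x = (ρ ^ (1 + (-(j + 1))) * ρ ^ (2 * j + 1)) x := by
        rw [hτρ, mul_assoc, hconj, ← mul_assoc, ← zpow_one_add, Equiv.Perm.mul_apply,
          Equiv.Perm.mul_apply, hk]
      rw [← zpow_add] at this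
      rw [show 1 + -(j + 1) + (2 * j + 1) = j + 1 by ring] at this
      exact this
  have hmap : ∀ x y, ρ.SameCycle x y → ρ.SameCycle (σ x) (σ y) := by
    rintro x y ⟨k, rfl⟩
    refine ⟨-k, ?_⟩
    rw [← Equiv.Perm.mul_apply, ← Equiv.Perm.mul_apply, hconj]
  let Q := Quotient (Equiv.Perm.SameCycle.setoid ρ)
  let mk : X → Q := fun x => Quotient.mk (Equiv.Perm.SameCycle.setoid ρ) x
  have hmk : ∀ x y, mk x = mk y ↔ ρ.SameCycle x y := fun x y => Quotient.eq
  -- So `σ` and `τ` both swap each `ρ`-cycle with the same partner cycle; an arbitrary order on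
  -- cycles decides which of the two is coloured `true`.
  let _ : LinearOrder Q := linearOrderOfSTO WellOrderingRel
  have hσσ : ∀ x, σ (σ x) = x := fun x => by rw [← Equiv.Perm.mul_apply, hσ]; rfl
  have hστ : ∀ x, mk (τ x) = mk (σ x) := fun x => by
    rw [hmk]
    exact Equiv.Perm.SameCycle.symm ⟨1, by rw [zpow_one, hρ, Equiv.Perm.mul_apply, hσσ]⟩
  have hσmk : ∀ x y, mk x = mk y → mk (σ x) = mk (σ y) := fun x y h => by
    rw [hmk] at h ⊢; exact hmap x y h
  have key : ∀ x y, mk y = mk (σ x) →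
      decide (mk y < mk (σ y)) = !decide (mk x < mk (σ x)) := by
    intro x y hy
    have h1 : mk (σ y) = mk x := by rw [hσmk _ _ hy, hσσ]
    have h2 : mk x ≠ mk (σ x) := fun h => hne x ((hmk _ _).1 h)
    rw [h1, hy]
    rcases lt_or_gt_of_ne h2 with h | h
    · simp [h, h.le]
    · simp [h, h.le]
  exact ⟨fun x => decide (mk x < mk (σ x)), fun x => ⟨key x _ rfl, key x _ (hστ x)⟩⟩

/-- Two involutions admit a 2-colouring that alternates wherever they move a point. -/
theorem exists_alternating {X : Type*} (σ τ : X → X)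
    (hσ : Function.Involutive σ) (hτ : Function.Involutive τ) :
    ∃ χ : X → Bool, (∀ x, σ x ≠ x → χ (σ x) = !χ x) ∧ ∀ x, τ x ≠ x → χ (τ x) = !χ x := by
  classical
  -- Fixed points are removed by doubling `X`: a fixed point is swapped with its copy.
  let D : (X → X) → X × Bool → X × Bool := fun f p =>
    if f p.1 = p.1 then (p.1, !p.2) else (f p.1, p.2)
  have hD : ∀ f, Function.Involutive f → Function.Involutive (D f) := by
    rintro f hf ⟨x, b⟩
    by_cases h : f x = x
    · simp [D, h]
    · have : ¬ x = f x := fun h' => h h'.symm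
      simp [D, h, hf x, this]
  have hD' : ∀ f p, D f p ≠ p := by
    rintro f ⟨x, b⟩
    by_cases h : f x = x <;> simp [D, h]
  have hmul : ∀ f (hf : Function.Involutive f), (hD f hf).toPerm * (hD f hf).toPerm = 1 := by
    intro f hf; ext1 p; exact hD f hf p
  obtain ⟨χ, hχ⟩ := exists_alternating_of_forall_ne (hD σ hσ).toPerm (hD τ hτ).toPerm
    (hmul σ hσ) (hmul τ hτ) (hD' σ) (hD' τ)
  refine ⟨fun x => χ (x, false), fun x hx => ?_, fun x hx => ?_⟩
  · simpa [D, hx] using (hχ (x, false)).1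
  · simpa [D, hx] using (hχ (x, false)).2

/-- An involution extends, by pairing fixed points in the same fibre of `g`, to one with at most one
fixed point in each fibre. -/
theorem exists_involutive_extension {X β : Type*} [Finite X] (g : X → β) (σ : X → X)
    (hσ : Function.Involutive σ) :
    ∃ σ' : X → X, Function.Involutive σ' ∧ (∀ x, σ x ≠ x → σ' x = σ x) ∧
      (∀ x, σ x = x → g (σ' x) = g x) ∧
      ∀ x y, σ' x = x → σ' y = y → g x = g y → x = y := by
  classical
  induction hn : {x | σ x = x}.ncard using Nat.strong_induction_on generalizing σ with
  | _ n ih =>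
    by_cases hex : ∃ x y, σ x = x ∧ σ y = y ∧ g x = g y ∧ x ≠ y
    · obtain ⟨x, y, hx, hy, hg, hxy⟩ := hex
      let σ₁ : X → X := fun z => if z = x then y else if z = y then x else σ z
      have e : ∀ z, z ≠ x → z ≠ y → σ₁ z = σ z := fun z h h' => by simp [σ₁, h, h']
      have ex : σ₁ x = y := by simp [σ₁]
      have ey : σ₁ y = x := by simp [σ₁, hxy.symm]
      have hinv : Function.Involutive σ₁ := by
        intro z
        by_cases h : z = x
        · rw [h, ex, ey]
        by_cases h' : z = y
        · rw [h', ey, ex]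
        rw [e z h h', e, hσ]
        · intro h2; apply h; rw [← hσ z, h2, hx]
        · intro h2; apply h'; rw [← hσ z, h2, hy]
      have hlt : {z | σ₁ z = z}.ncard < n := by
        rw [← hn]
        apply Set.ncard_lt_ncard _ (Set.toFinite _)
        refine ⟨fun z hz => ?_, fun hs => ?_⟩
        · have h : z ≠ x := by rintro rfl; exact hxy (ex.symm.trans hz).symm
          have h' : z ≠ y := by rintro rfl; exact hxy (ey.symm.trans hz)
          exact (e z h h').symm.trans hz
        · exact hxy ((hs hx : σ₁ x = x).symm.trans ex)
      obtain ⟨σ', h1, h2, h3, h4⟩ := ih _ hlt σ₁ hinv rfl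
      refine ⟨σ', h1, fun z hz => ?_, fun z hz => ?_, h4⟩
      · have h : z ≠ x := by rintro rfl; exact hz hx
        have h' : z ≠ y := by rintro rfl; exact hz hy
        rw [h2 z (by rwa [e z h h']), e z h h']
      · by_cases h : z = x
        · rw [h, h2 x (by rw [ex]; exact hxy.symm), ex, hg]
        by_cases h' : z = y
        · rw [h', h2 y (by rw [ey]; exact hxy), ey, hg]
        exact h3 z (by rw [e z h h', hz])
    · push Not at hex
      exact ⟨σ, hσ, fun _ _ => rfl, fun x hx => by rw [hx], hex⟩

/-- A colouring alternating along an involution that preserves `A` and has at most one fixed point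
there is equitable on `A`. -/
theorem IsEquitableOn.of_alternating {X : Type*} [DecidableEq X] (A : Finset X) (σ : X → X)
    (hσ : Function.Involutive σ) (hA : ∀ x ∈ A, σ x ∈ A)
    (hfix : ∀ x ∈ A, ∀ y ∈ A, σ x = x → σ y = y → x = y) (χ : X → Bool)
    (hχ : ∀ x, σ x ≠ x → χ (σ x) = !χ x) : IsEquitableOn A χ := by
  have key : ∀ b, #{x ∈ A | χ x = b} ≤ #{x ∈ A | χ x = !b} + 1 := by
    intro b
    have h1 : #{x ∈ A | χ x = b} ≤
        #({x ∈ A | σ x ≠ x ∧ χ x = b} ∪ {x ∈ A | σ x = x}) := by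
      apply card_le_card
      intro x hx
      simp only [mem_union, mem_filter] at hx ⊢
      tauto
    have h2 : #{x ∈ A | σ x ≠ x ∧ χ x = b} ≤ #{x ∈ A | χ x = !b} := by
      apply card_le_card_of_injOn σ _ hσ.injective.injOn
      intro x hx
      simp only [coe_filter, Set.mem_ofPred_eq] at hx ⊢
      exact ⟨hA x hx.1, by rw [hχ x hx.2.1, hx.2.2]⟩
    have h3 : #{x ∈ A | σ x = x} ≤ 1 := by
      rw [card_le_one]
      intro x hx y hy
      rw [mem_filter] at hx hy
      exact hfix x hx.1 y hy.1 hx.2 hy.2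
    have := card_union_le {x ∈ A | σ x ≠ x ∧ χ x = b} {x ∈ A | σ x = x}
    omega
  intro s t
  rcases Bool.eq_or_eq_not t s with rfl | rfl
  · omega
  · exact key s

/-- Balanced 2-colourings for a chain of partitions together with one further partition. -/
theorem exists_bisection {X β₁ β₂ β₃ γ : Type*} [Fintype X] [DecidableEq X] [DecidableEq β₁]
    [DecidableEq β₂] [DecidableEq β₃] [DecidableEq γ] (p₁ : X → β₁) (p₂ : X → β₂) (p₃ : X → β₃)
    (q : X → γ) (h₁₂ : ∀ x y, p₁ x = p₁ y → p₂ x = p₂ y)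
    (h₂₃ : ∀ x y, p₂ x = p₂ y → p₃ x = p₃ y) :
    ∃ χ : X → Bool, (∀ v, IsEquitableOn {x | p₁ x = v} χ) ∧ (∀ v, IsEquitableOn {x | p₂ x = v} χ) ∧
      (∀ v, IsEquitableOn {x | p₃ x = v} χ) ∧ ∀ v, IsEquitableOn {x | q x = v} χ := by
  have hid : Function.Involutive (id : X → X) := fun _ => rfl
  -- Each `σ` keeps the pairs of the previous one, so a colouring that alternates along `σ₃`
  -- alternates along all three.
  obtain ⟨σ₁, i₁, -, g₁, f₁⟩ := exists_involutive_extension p₁ id hid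
  obtain ⟨σ₂, i₂, e₂, g₂, f₂⟩ := exists_involutive_extension p₂ σ₁ i₁
  obtain ⟨σ₃, i₃, e₃, g₃, f₃⟩ := exists_involutive_extension p₃ σ₂ i₂
  obtain ⟨τ, j, -, g, f⟩ := exists_involutive_extension q id hid
  obtain ⟨χ, hχ₃, hχ⟩ := exists_alternating σ₃ τ i₃ j
  have hχ₂ : ∀ x, σ₂ x ≠ x → χ (σ₂ x) = !χ x := fun x hx => by
    rw [← e₃ x hx]; exact hχ₃ x (by rwa [e₃ x hx])
  have hχ₁ : ∀ x, σ₁ x ≠ x → χ (σ₁ x) = !χ x := fun x hx => by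
    rw [← e₂ x hx]; exact hχ₂ x (by rwa [e₂ x hx])
  have k₁ : ∀ x, p₁ (σ₁ x) = p₁ x := fun x => g₁ x rfl
  have k₂ : ∀ x, p₂ (σ₂ x) = p₂ x := fun x => by
    by_cases h : σ₁ x = x
    · exact g₂ x h
    · rw [e₂ x h]; exact h₁₂ _ _ (k₁ x)
  have k₃ : ∀ x, p₃ (σ₃ x) = p₃ x := fun x => by
    by_cases h : σ₂ x = x
    · exact g₃ x h
    · rw [e₃ x h]; exact h₂₃ _ _ (k₂ x)
  refine ⟨χ, fun v => .of_alternating _ σ₁ i₁ ?_ ?_ χ hχ₁,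
    fun v => .of_alternating _ σ₂ i₂ ?_ ?_ χ hχ₂, fun v => .of_alternating _ σ₃ i₃ ?_ ?_ χ hχ₃,
    fun v => .of_alternating _ τ j ?_ ?_ χ hχ⟩ <;> simp only [mem_filter, mem_univ, true_and]
  · intro x hx; rw [k₁, hx]
  · intro x hx y hy h h'; exact f₁ x y h h' (hx.trans hy.symm)
  · intro x hx; rw [k₂, hx]
  · intro x hx y hy h h'; exact f₂ x y h h' (hx.trans hy.symm)
  · intro x hx; rw [k₃, hx]
  · intro x hx y hy h h'; exact f₃ x y h h' (hx.trans hy.symm)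
  · intro x hx; rw [g x rfl, hx]
  · intro x hx y hy h h'; exact f x y h h' (hx.trans hy.symm)

/-! ### From two colours to many -/

/-- Sum of the squares of the sizes of the colour classes. -/
def colourEnergy {X κ : Type*} [Fintype κ] [DecidableEq κ] (A : Finset X) (h : X → κ) : ℕ :=
  ∑ s, #{x ∈ A | h x = s} ^ 2

/-- Rebalancing two colour classes does not increase the energy, and decreases it if their sizes
differed by at least two. -/
theorem colourEnergy_recolour {X κ : Type*} [DecidableEq X] [Fintype κ] [DecidableEq κ]
    (A : Finset X) (h : X → κ) {s t : κ} (hst : s ≠ t) (χ : X → Bool)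
    (hχ : IsEquitableOn {x ∈ A | h x = s ∨ h x = t} χ) :
    colourEnergy A (fun x => if h x = s ∨ h x = t then (if χ x then s else t) else h x) ≤
        colourEnergy A h ∧
      (#{x ∈ A | h x = t} + 1 < #{x ∈ A | h x = s} →
        colourEnergy A (fun x => if h x = s ∨ h x = t then (if χ x then s else t) else h x) <
          colourEnergy A h) := by
  set h' : X → κ := fun x => if h x = s ∨ h x = t then (if χ x then s else t) else h x with hh'
  have es : {x ∈ A | h' x = s} = {x ∈ {x ∈ A | h x = s ∨ h x = t} | χ x = true} := by
    ext x
    simp only [mem_filter, hh']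
    by_cases h1 : h x = s ∨ h x = t
    · cases h2 : χ x <;> simp [h1, hst.symm]
    · simp only [h1, if_false]; tauto
  have et : {x ∈ A | h' x = t} = {x ∈ {x ∈ A | h x = s ∨ h x = t} | χ x = false} := by
    ext x
    simp only [mem_filter, hh']
    by_cases h1 : h x = s ∨ h x = t
    · cases h2 : χ x <;> simp [h1, hst]
    · simp only [h1, if_false]; tauto
  have eo : ∀ u, u ≠ s → u ≠ t → {x ∈ A | h' x = u} = {x ∈ A | h x = u} := by
    intro u hus hut
    ext x
    simp only [mem_filter, hh']
    by_cases h1 : h x = s ∨ h x = t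
    · have h3 : h x ≠ u := by rintro rfl; tauto
      cases h2 : χ x <;> simp [h1, hus.symm, hut.symm, h3]
    · simp only [h1, if_false]
  have hsum : #{x ∈ A | h' x = s} + #{x ∈ A | h' x = t} =
      #{x ∈ A | h x = s} + #{x ∈ A | h x = t} := by
    rw [es, et]
    have h1 := card_filter_add_card_filter_not (s := {x ∈ A | h x = s ∨ h x = t})
      (fun x => χ x = true)
    simp only [Bool.not_eq_true] at h1
    rw [h1, filter_or, card_union_of_disjoint]
    rw [disjoint_filter]
    rintro x - h2 h3
    exact hst (h2.symm.trans h3)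
  have d1 := hχ true false
  have d2 := hχ false true
  rw [← es, ← et] at d1 d2
  have split : ∀ f : X → κ, colourEnergy A f =
      #{x ∈ A | f x = s} ^ 2 + (#{x ∈ A | f x = t} ^ 2 +
        ∑ u ∈ (univ.erase s).erase t, #{x ∈ A | f x = u} ^ 2) := by
    intro f
    rw [colourEnergy, ← add_sum_erase _ _ (mem_univ s), ← add_sum_erase (univ.erase s) _
      (mem_erase.2 ⟨hst.symm, mem_univ t⟩)]
  have rest : ∑ u ∈ (univ.erase s).erase t, #{x ∈ A | h' x = u} ^ 2 =
      ∑ u ∈ (univ.erase s).erase t, #{x ∈ A | h x = u} ^ 2 := by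
    apply sum_congr rfl
    intro u hu
    rw [mem_erase, mem_erase] at hu
    rw [eo u hu.2.1 hu.1]
  rw [split h', split h, rest]
  generalize #{x ∈ A | h' x = s} = a at *
  generalize #{x ∈ A | h' x = t} = b at *
  generalize #{x ∈ A | h x = s} = c at *
  generalize #{x ∈ A | h x = t} = d at *
  -- With `a + b = c + d` fixed, `a² + b²` is least when `a` and `b` differ by at most one.
  have hab : a = b ∨ a = b + 1 ∨ b = a + 1 := by omega
  constructor
  · rcases hab with rfl | rfl | rfl
    · zify at *; nlinarith [sq_nonneg ((c : ℤ) - d)]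
    · rcases lt_or_ge c d with h | h <;> zify at * <;> nlinarith
    · rcases lt_or_ge c d with h | h <;> zify at * <;> nlinarith
  · intro hlt
    rcases hab with rfl | rfl | rfl <;> zify at * <;> nlinarith

/-- If a family of sets can be bisected within every subset, it admits equitable colourings with any
number of colours. -/
theorem exists_isEquitableOn_of_bisection {X κ : Type*} [Finite X] [DecidableEq X]
    [Fintype κ] [DecidableEq κ] [Nonempty κ] (F : Finset (Finset X))
    (hF : ∀ Y : X → Prop, [DecidablePred Y] →
      ∃ χ : X → Bool, ∀ A ∈ F, IsEquitableOn {x ∈ A | Y x} χ) :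
    ∃ h : X → κ, ∀ A ∈ F, IsEquitableOn A h := by
  obtain ⟨h, hmin⟩ := Finite.exists_min fun h : X → κ => ∑ A ∈ F, colourEnergy A h
  refine ⟨h, fun A hA s t => ?_⟩
  by_contra! hlt
  have hst : s ≠ t := by rintro rfl; omega
  obtain ⟨χ, hχ⟩ := hF fun x => h x = s ∨ h x = t
  refine (hmin fun x => if h x = s ∨ h x = t then (if χ x then s else t) else h x).not_gt ?_
  exact sum_lt_sum (fun B hB => (colourEnergy_recolour B h hst χ (hχ B hB)).1)
    ⟨A, hA, (colourEnergy_recolour A h hst χ (hχ A hA)).2 hlt⟩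

/-- Equitable colourings for the partitions `p₁ ≤ p₂ ≤ ⊤` and a further partition `q`. -/
theorem exists_isEquitableOn {X β₁ β₂ γ : Type*} (κ : Type*) [Fintype X] [DecidableEq X]
    [DecidableEq β₁] [DecidableEq β₂] [DecidableEq γ] [Fintype κ] [DecidableEq κ] [Nonempty κ]
    (p₁ : X → β₁) (p₂ : X → β₂) (q : X → γ) (h₁₂ : ∀ x y, p₁ x = p₁ y → p₂ x = p₂ y) :
    ∃ h : X → κ, (∀ v, IsEquitableOn {x | p₁ x = v} h) ∧ (∀ v, IsEquitableOn {x | p₂ x = v} h) ∧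
      IsEquitableOn univ h ∧ ∀ v, IsEquitableOn {x | q x = v} h := by
  classical
  obtain ⟨h, hh⟩ := exists_isEquitableOn_of_bisection (κ := κ) (X := X)
    ({A | (∃ v, A = univ.filter fun x => p₁ x = v) ∨ (∃ v, A = univ.filter fun x => p₂ x = v) ∨ A = univ ∨
      ∃ v, A = univ.filter fun x => q x = v} : Finset (Finset X)) (by
    intro Y _
    -- Tagging with `decide (Y x)` makes the fibre over `(v, true)` the class cut down to `Y`; the
    -- tag alone is the coarsest partition and handles `univ`.
    obtain ⟨χ, c₁, c₂, c₃, c⟩ := exists_bisection (fun x => (p₁ x, decide (Y x)))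
      (fun x => (p₂ x, decide (Y x))) (fun x => decide (Y x)) (fun x => (q x, decide (Y x)))
      (by simp only [Prod.mk.injEq]; exact fun x y h => ⟨h₁₂ x y h.1, h.2⟩)
      (by simp only [Prod.mk.injEq]; exact fun x y h => h.2)
    refine ⟨χ, fun A hA => ?_⟩
    rw [mem_filter] at hA
    rcases hA.2 with ⟨v, rfl⟩ | ⟨v, rfl⟩ | rfl | ⟨v, rfl⟩
    · simpa [filter_filter] using c₁ (v, true)
    · simpa [filter_filter] using c₂ (v, true)
    · simpa using c₃ true
    · simpa [filter_filter] using c (v, true))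
  simp only [mem_filter, mem_univ, true_and] at hh
  exact ⟨h, fun v => hh _ (.inl ⟨v, rfl⟩), fun v => hh _ (.inr (.inl ⟨v, rfl⟩)),
    hh _ (.inr (.inr (.inl rfl))), fun v => hh _ (.inr (.inr (.inr ⟨v, rfl⟩)))⟩

/-! ### Class sizes and balanced rows -/

/-- The classes of an equitable colouring of `A` have size `⌊#A / #κ⌋` or `⌈#A / #κ⌉`. -/
theorem IsEquitableOn.card_eq_floor_or_ceil {X κ : Type*} [Fintype κ] [DecidableEq κ]
    {A : Finset X} {h : X → κ} (hA : IsEquitableOn A h) (s : κ) :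
    #{x ∈ A | h x = s} = ⌊(#A : ℚ) / Fintype.card κ⌋₊ ∨
      #{x ∈ A | h x = s} = ⌈(#A : ℚ) / Fintype.card κ⌉₊ := by
  have hpos : 0 < Fintype.card κ := Fintype.card_pos_iff.2 ⟨s⟩
  have hsum : #A = ∑ t, #{x ∈ A | h x = t} :=
    card_eq_sum_card_fiberwise fun x _ => mem_coe.2 (mem_univ (h x))
  have e : ∑ _t : κ, (#{x ∈ A | h x = s} + 1) = Fintype.card κ * (#{x ∈ A | h x = s} + 1) := by
    simp
  have up : #A < Fintype.card κ * (#{x ∈ A | h x = s} + 1) := by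
    rw [hsum, ← e]
    exact sum_lt_sum (fun t _ => hA t s) ⟨s, mem_univ s, Nat.lt_succ_self _⟩
  have lo : Fintype.card κ * #{x ∈ A | h x = s} < #A + Fintype.card κ := by
    have e₁ : ∑ t : κ, (#{x ∈ A | h x = t} + 1) = #A + Fintype.card κ := by
      rw [sum_add_distrib, ← hsum]; simp
    have e₂ : ∑ _t : κ, #{x ∈ A | h x = s} = Fintype.card κ * #{x ∈ A | h x = s} := by simp
    rw [← e₁, ← e₂]
    exact sum_lt_sum (fun t _ => hA s t) ⟨s, mem_univ s, Nat.lt_succ_self _⟩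
  generalize #{x ∈ A | h x = s} = k at *
  have hq : (0 : ℚ) < Fintype.card κ := by exact_mod_cast hpos
  have h1 : ⌊(#A : ℚ) / Fintype.card κ⌋₊ ≤ k := by
    rw [← Nat.lt_succ_iff, Nat.floor_lt (by positivity), div_lt_iff₀ hq, mul_comm]
    exact_mod_cast up
  have h2 : k ≤ ⌈(#A : ℚ) / Fintype.card κ⌉₊ := by
    rw [← Nat.lt_succ_iff, Nat.succ_eq_add_one]
    have h3 := Nat.le_ceil ((#A : ℚ) / Fintype.card κ)
    rw [div_le_iff₀ hq] at h3
    have h4 : #A ≤ ⌈(#A : ℚ) / Fintype.card κ⌉₊ * Fintype.card κ := by exact_mod_cast h3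
    by_contra! h5
    nlinarith
  have h3 := Nat.ceil_le_floor_add_one ((#A : ℚ) / Fintype.card κ)
  omega

/-- A set with at least as many elements as colours meets every class of an equitable colouring. -/
theorem IsEquitableOn.exists_eq {X κ : Type*} [Fintype κ] [DecidableEq κ]
    {A : Finset X} {h : X → κ} (hA : IsEquitableOn A h) (hcard : Fintype.card κ ≤ #A) (s : κ) :
    ∃ x ∈ A, h x = s := by
  have hpos : 0 < Fintype.card κ := Fintype.card_pos_iff.2 ⟨s⟩
  have hfl : 0 < ⌊(#A : ℚ) / Fintype.card κ⌋₊ := by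
    rw [Nat.floor_pos, one_le_div (by exact_mod_cast hpos)]
    exact_mod_cast hcard
  have hle := Nat.floor_le_ceil ((#A : ℚ) / Fintype.card κ)
  have : 0 < #{x ∈ A | h x = s} := by
    rcases hA.card_eq_floor_or_ceil s with h | h <;> omega
  obtain ⟨x, hx⟩ := card_pos.1 this
  exact ⟨x, (mem_filter.1 hx).1, (mem_filter.1 hx).2⟩

/-- If the number of colours divides `#A`, the classes of an equitable colouring of `A` all have the
same size. -/
theorem IsEquitableOn.card_eq_of_mul_eq {X κ : Type*} [Fintype κ] [DecidableEq κ]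
    {A : Finset X} {h : X → κ} (hA : IsEquitableOn A h) {m : ℕ} (hm : m * Fintype.card κ = #A)
    (s : κ) : #{x ∈ A | h x = s} = m := by
  have hpos : 0 < Fintype.card κ := Fintype.card_pos_iff.2 ⟨s⟩
  have hq : (#A : ℚ) / Fintype.card κ = m := by
    rw [div_eq_iff (by exact_mod_cast hpos.ne')]
    exact_mod_cast hm.symm
  simpa [hq] using hA.card_eq_floor_or_ceil s

theorem isEquitableOn_of_card_eq {X κ : Type*} [DecidableEq κ] {A : Finset X} {h : X → κ} (m : ℕ)
    (hm : ∀ s, #{x ∈ A | h x = s} = m) : IsEquitableOn A h := fun s t => by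
  rw [hm s, hm t]; omega

theorem ncard_setOf_comp_equiv {ι X : Type*} [Fintype X] (φ : ι ≃ X) (P : X → Prop)
    [DecidablePred P] : {j | P (φ j)}.ncard = #{x | P x} := by
  rw [← Set.ncard_coe_finset, ← Set.ncard_image_of_injective _ φ.injective]
  congr 1
  ext x
  simp only [Set.mem_image, Set.mem_ofPred_eq, coe_filter, mem_univ, true_and]
  exact ⟨fun ⟨j, hj, h⟩ => h ▸ hj, fun h => ⟨φ.symm x, by simpa using h, by simp⟩⟩

theorem IsEquitableOn.isBalancedVector {X : Type*} [Fintype X] {n g : ℕ} [NeZero g]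
    {f : X → ZMod g} (hf : IsEquitableOn univ f) (φ : Fin n ≃ X) :
    IsBalancedVector fun j => f (φ j) := by
  intro s
  have := hf.card_eq_floor_or_ceil s
  rw [card_univ, ← Fintype.card_congr φ, Fintype.card_fin, ZMod.card] at this
  rwa [ncard_setOf_comp_equiv φ fun x => f x = s]

theorem IsPairwiseBalanced.symm {n g₁ g₂ : ℕ} {x : Fin n → ZMod g₁} {y : Fin n → ZMod g₂}
    (h : IsPairwiseBalanced x y) : IsPairwiseBalanced y x := by
  refine ⟨h.2.1, h.1, fun a b => ?_⟩
  simpa only [and_comm, mul_comm] using h.2.2 b a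

/-- A row with all symbols equally frequent is pairwise balanced with any equitable row that is
equitable on its fibres. -/
theorem isPairwiseBalanced_of_isEquitableOn {X : Type*} [Fintype X] {n g₁ g₂ : ℕ} [NeZero g₁]
    [NeZero g₂] {f : X → ZMod g₁} {h : X → ZMod g₂} (φ : Fin n ≃ X) (m : ℕ)
    (hf : ∀ s, #{x | f x = s} = m) (hh : IsEquitableOn univ h)
    (hfh : ∀ s, IsEquitableOn {x | f x = s} h) :
    IsPairwiseBalanced (fun j => f (φ j)) fun j => h (φ j) := by
  refine ⟨(isEquitableOn_of_card_eq m hf).isBalancedVector φ, hh.isBalancedVector φ,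
    fun s t => ?_⟩
  have hn : n = g₁ * m := by
    have h1 := card_eq_sum_card_fiberwise (f := f) (s := univ) (t := univ)
      fun x _ => mem_coe.2 (mem_univ _)
    rw [card_univ, ← Fintype.card_congr φ, Fintype.card_fin] at h1
    simpa [hf, ZMod.card] using h1
  have hg : (g₁ : ℚ) ≠ 0 := Nat.cast_ne_zero.2 (NeZero.ne g₁)
  have hq : (n : ℚ) / (g₁ * g₂) = (m : ℚ) / g₂ := by
    rw [hn, Nat.cast_mul, mul_div_mul_left _ _ hg]
  have := (hfh s).card_eq_floor_or_ceil t
  rw [hf, ZMod.card, filter_filter] at this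
  rwa [ncard_setOf_comp_equiv φ fun x => f x = s ∧ h x = t, hq]

/-- The set is a disjoint union of fibres of `p`, each contributing `m`. This gives uniformity of
row 3 alone and jointly with row 1 or row 2. -/
theorem card_filter_comp_and {X β γ κ : Type*} [Fintype X] [Fintype β] [DecidableEq β]
    [DecidableEq γ] [DecidableEq κ] {p : X → β} {h : X → κ} {m : ℕ}
    (hm : ∀ u s, #{x | p x = u ∧ h x = s} = m) (π : β → γ) (v : γ) (s : κ) :
    #{x | π (p x) = v ∧ h x = s} = #{u | π u = v} * m := by
  rw [card_eq_sum_card_fiberwise (f := p) (t := {u | π u = v})]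
  · rw [sum_const_nat]
    intro u hu
    rw [← hm u s, filter_filter]
    congr 1
    ext x
    simp only [mem_filter, mem_univ, true_and] at hu ⊢
    constructor
    · tauto
    · rintro ⟨rfl, h⟩; tauto
  · intro x hx
    simp only [coe_filter, mem_univ, true_and, Set.mem_ofPred_eq] at hx ⊢
    exact hx.1

theorem card_filter_mem_triple {α β γ : Type*} [Fintype α] [Fintype β] [Fintype γ] [DecidableEq α]
    [DecidableEq β] [DecidableEq γ] (A : Finset α) (B : Finset β) (C : Finset γ) :
    #{x : α × β × γ | x.1 ∈ A ∧ x.2.1 ∈ B ∧ x.2.2 ∈ C} = #A * (#B * #C) := by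
  rw [← card_product, ← card_product]
  congr 1
  ext x
  simp only [mem_filter, mem_univ, mem_product, true_and]

/-! ### Construction of the array -/

/-- The rows of `v₃` and `v₄`, when the columns are indexed by the entries in the rows of `v₀`,
`v₁` and `v₂`. -/
theorem exists_rows (a b c d e : ℕ) [NeZero a] [NeZero b] [NeZero c] [NeZero d] [NeZero e]
    (hda : d ∣ a) (hde : d * e ≤ b * c) :
    ∃ (y : ZMod a × ZMod b × ZMod c → ZMod d) (z : ZMod a × ZMod b × ZMod c → ZMod e) (m : ℕ),
      0 < m ∧ (∀ u l, #{x | x.2 = u ∧ y x = l} = m) ∧ (∀ i, IsEquitableOn {x | x.1 = i} y) ∧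
      IsEquitableOn univ z ∧ (∀ i, IsEquitableOn {x | x.1 = i} z) ∧
      (∀ l, IsEquitableOn {x | y x = l} z) ∧ ∀ i l s, ∃ x, x.1 = i ∧ y x = l ∧ z x = s := by
  obtain ⟨m, rfl⟩ := hda
  -- Only one partition is needed besides the cross partition, so the chain repeats it.
  obtain ⟨y, y₁, -, -, y₂⟩ := exists_isEquitableOn (ZMod d)
    (fun x : ZMod (d * m) × ZMod b × ZMod c => x.2) (fun x => x.2) (fun x => x.1) fun _ _ => id
  obtain ⟨z, z₁, z₂, z₃, z₄⟩ := exists_isEquitableOn (ZMod e)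
    (fun x : ZMod (d * m) × ZMod b × ZMod c => (x.1, y x)) (fun x => x.1) y
    fun _ _ h => (Prod.ext_iff.1 h).1
  refine ⟨y, z, m, ?_, fun u l => ?_, y₂, z₃, z₂, z₄, fun i l s => ?_⟩
  · exact Nat.pos_of_ne_zero (right_ne_zero_of_mul (NeZero.ne (d * m)))
  · rw [← filter_filter]
    apply (y₁ u).card_eq_of_mul_eq
    have : ({x | x.2 = u} : Finset (ZMod (d * m) × ZMod b × ZMod c)) = univ ×ˢ {u} := by
      ext x; simp only [mem_filter, mem_univ, mem_product, mem_singleton]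
    rw [this, card_product, card_univ, ZMod.card, ZMod.card, card_singleton]; ring
  · have hc : #({x | x.1 = i} : Finset (ZMod (d * m) × ZMod b × ZMod c)) = b * c := by
      have : ({x | x.1 = i} : Finset (ZMod (d * m) × ZMod b × ZMod c)) = {i} ×ˢ univ := by
        ext x; simp only [mem_filter, mem_univ, mem_product, mem_singleton]; tauto
      rw [this, card_product, card_univ, Fintype.card_prod, ZMod.card, ZMod.card, card_singleton,
        one_mul]
    -- The fibre of `(i, l)` has at least `⌊bc / d⌋` points, enough for all `e` symbols.
    have hfl : e ≤ ⌊((b * c : ℕ) : ℚ) / d⌋₊ := by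
      apply Nat.le_floor
      rw [le_div_iff₀ (Nat.cast_pos.2 (Nat.pos_of_ne_zero (NeZero.ne d))), mul_comm]
      exact_mod_cast hde
    have hle := Nat.floor_le_ceil (((b * c : ℕ) : ℚ) / d)
    have hk := (y₂ i).card_eq_floor_or_ceil l
    rw [hc, ZMod.card, filter_filter] at hk
    obtain ⟨x, hx, hs⟩ := (z₁ (i, l)).exists_eq (s := s) (by
      simp only [Prod.mk.injEq, ZMod.card]
      rcases hk with h | h <;> rw [h] <;> omega)
    simp only [mem_filter, mem_univ, true_and, Prod.mk.injEq] at hx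
    exact ⟨x, hx.1, hx.2, hs⟩

/-- Finiteness bounds the set of products; the `sSup` of an unbounded set in `ℕ` would be 0. -/
theorem mul_le_productWeight {α : Type*} (H : Hypergraph α) (w : α → ℕ)
    (hfin : H.vertexSet.Finite) {u v x : α} (huv : u ≠ v) (hux : u ≠ x) (hvx : v ≠ x)
    (he : ({u, v, x} : Set α) ∈ H.edgeSet) : w u * w v * w x ≤ productWeight H w := by
  refine le_csSup ?_ ⟨u, v, x, huv, hux, hvx, he, rfl⟩
  refine ((((hfin.prod hfin).prod hfin).image
    fun p : (α × α) × α => w p.1.1 * w p.1.2 * w p.2).subset ?_).bddAbove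
  rintro p ⟨u, v, x, -, -, -, he, rfl⟩
  have hs := H.subset_vertexSet_of_mem_edgeSet he
  exact ⟨((u, v), x), ⟨⟨hs (by simp), hs (by simp)⟩, hs (by simp)⟩, rfl⟩

theorem mainTheorem4 {α : Type*} (H : Hypergraph α) (v : Fin 5 → α)
    (hv : Function.Injective v)
    (hV : H.vertexSet = Set.range v)
    (hE : H.edgeSet = {{v 0, v 1, v 2}, {v 1, v 2, v 3}, {v 3, v 4, v 0}})
    (w : α → ℕ) (hw : ∀ x ∈ H.vertexSet, 0 < w x)
    (hPW : w (v 0) * w (v 1) * w (v 2) = productWeight H w)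
    (hmod : w (v 0) ≡ 0 [MOD w (v 3)])
    (hle : w (v 3) ≤ min (w (v 0)) (max (w (v 1)) (w (v 2)))) :
    ∃ C : (x : H.vertexSet) → Fin (productWeight H w) → ZMod (w x),
      IsBalancedCoveringArray H w C := by
  have hmem : ∀ i, v i ∈ H.vertexSet := fun i => hV ▸ Set.mem_range_self i
  have hne : ∀ i, NeZero (w (v i)) := fun i => ⟨(hw _ (hmem i)).ne'⟩
  -- The third edge weighs at most the first; cancel `w (v 0)`.
  have hde : w (v 3) * w (v 4) ≤ w (v 1) * w (v 2) := by
    have h := mul_le_productWeight H w (hV ▸ Set.finite_range v) (u := v 3) (v := v 4) (x := v 0)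
      (hv.ne (by decide)) (hv.ne (by decide)) (hv.ne (by decide)) (by rw [hE]; simp)
    rw [← hPW, mul_assoc (w (v 0)), mul_comm _ (w (v 0))] at h
    exact Nat.le_of_mul_le_mul_left h (hw _ (hmem 0))
  obtain ⟨y, z, m, hm, y₁, y₂, z₁, z₂, z₃, z₄⟩ := exists_rows (w (v 0)) (w (v 1)) (w (v 2))
    (w (v 3)) (w (v 4)) (Nat.modEq_zero_iff_dvd.1 hmod) hde
  let X := ZMod (w (v 0)) × ZMod (w (v 1)) × ZMod (w (v 2))
  have hX : Fintype.card X = productWeight H w := by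
    rw [← hPW, Fintype.card_prod, Fintype.card_prod, ZMod.card, ZMod.card, ZMod.card, mul_assoc]
  let φ : Fin (productWeight H w) ≃ X := (Fintype.equivFinOfCardEq hX).symm
  let R : (i : Fin 5) → Fin (productWeight H w) → ZMod (w (v i)) := fun i =>
    match i with
    | 0 => fun j => (φ j).1
    | 1 => fun j => (φ j).2.1
    | 2 => fun j => (φ j).2.2
    | 3 => fun j => y (φ j)
    | 4 => fun j => z (φ j)
  let ν : Fin 5 → H.vertexSet := fun i => ⟨v i, hmem i⟩
  have hν : Function.Bijective ν := by
    refine ⟨fun i j h => hv (congrArg Subtype.val h), fun ⟨x, hx⟩ => ?_⟩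
    obtain ⟨i, rfl⟩ := hV ▸ hx
    exact ⟨i, rfl⟩
  obtain ⟨C, hC⟩ : ∃ C : (x : H.vertexSet) → Fin (productWeight H w) → ZMod (w x),
      ∀ i, C (ν i) = R i :=
    ⟨(Equiv.ofBijective ν hν).piCongrLeft (fun x : H.vertexSet => Fin (productWeight H w) → ZMod (w x)) R,
      fun i => Equiv.piCongrLeft_apply_apply
        (fun x : H.vertexSet => Fin (productWeight H w) → ZMod (w x)) (Equiv.ofBijective ν hν) R i⟩
  have box (A : Finset (ZMod (w (v 0)))) (B : Finset (ZMod (w (v 1)))) (C : Finset (ZMod (w (v 2)))) :=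
    card_filter_mem_triple A B C
  -- sizes of the fibres of the first four rows
  have f₀ : ∀ s, #{x : X | x.1 = s} = w (v 1) * w (v 2) := fun s => by
    simpa using box {s} univ univ
  have f₁ : ∀ s, #{x : X | x.2.1 = s} = w (v 0) * w (v 2) := fun s => by
    simpa using box univ {s} univ
  have f₂ : ∀ s, #{x : X | x.2.2 = s} = w (v 0) * w (v 1) := fun s => by
    simpa using box univ univ {s}
  have f₃ : ∀ s, #{x : X | y x = s} = w (v 1) * w (v 2) * m := fun s => by
    simpa using card_filter_comp_and y₁ (fun _ => ()) () s
  have e₁ : IsEquitableOn univ fun x : X => x.2.1 := isEquitableOn_of_card_eq _ f₁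
  have e₂ : IsEquitableOn univ fun x : X => x.2.2 := isEquitableOn_of_card_eq _ f₂
  have e₃ : IsEquitableOn univ y := isEquitableOn_of_card_eq _ f₃
  have p₀₁ : IsPairwiseBalanced (R 0) (R 1) :=
    isPairwiseBalanced_of_isEquitableOn φ _ f₀ e₁ fun s =>
      isEquitableOn_of_card_eq (w (v 2)) fun t => by
        simpa [filter_filter] using box {s} {t} univ
  have p₀₂ : IsPairwiseBalanced (R 0) (R 2) :=
    isPairwiseBalanced_of_isEquitableOn φ _ f₀ e₂ fun s =>
      isEquitableOn_of_card_eq (w (v 1)) fun t => by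
        simpa [filter_filter] using box {s} univ {t}
  have p₁₂ : IsPairwiseBalanced (R 1) (R 2) :=
    isPairwiseBalanced_of_isEquitableOn φ _ f₁ e₂ fun s =>
      isEquitableOn_of_card_eq (w (v 0)) fun t => by
        simpa [filter_filter] using box univ {s} {t}
  have p₁₃ : IsPairwiseBalanced (R 1) (R 3) :=
    isPairwiseBalanced_of_isEquitableOn φ _ f₁ e₃ fun s =>
      isEquitableOn_of_card_eq _ fun t => by
        rw [filter_filter]; exact card_filter_comp_and y₁ Prod.fst s t
  have p₂₃ : IsPairwiseBalanced (R 2) (R 3) :=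
    isPairwiseBalanced_of_isEquitableOn φ _ f₂ e₃ fun s =>
      isEquitableOn_of_card_eq _ fun t => by
        rw [filter_filter]; exact card_filter_comp_and y₁ Prod.snd s t
  have p₀₃ : IsPairwiseBalanced (R 0) (R 3) := isPairwiseBalanced_of_isEquitableOn φ _ f₀ e₃ y₂
  have p₀₄ : IsPairwiseBalanced (R 0) (R 4) := isPairwiseBalanced_of_isEquitableOn φ _ f₀ z₁ z₂
  have p₃₄ : IsPairwiseBalanced (R 3) (R 4) := isPairwiseBalanced_of_isEquitableOn φ _ f₃ z₁ z₃
  refine ⟨C, fun E hEE s => ?_, fun x => ?_, fun E hEE x x' hxx' hx hx' => ?_⟩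
  · suffices h : ∃ j, ∀ i, v i ∈ E → R i j = s (ν i) by
      obtain ⟨j, hj⟩ := h
      refine ⟨j, fun x hx => ?_⟩
      obtain ⟨i, rfl⟩ := hν.2 x
      rw [hC]
      exact hj i hx
    rw [hE] at hEE
    rcases hEE with rfl | rfl | rfl
    · refine ⟨φ.symm (s (ν 0), s (ν 1), s (ν 2)), fun i hi => ?_⟩
      simp only [Set.mem_insert_iff, Set.mem_singleton_iff, hv.eq_iff] at hi
      rcases hi with rfl | rfl | rfl <;> simp [R]
    · obtain ⟨x, hx⟩ := card_pos.1 (hm.trans_eq (y₁ (s (ν 1), s (ν 2)) (s (ν 3))).symm)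
      simp only [mem_filter, mem_univ, true_and] at hx
      refine ⟨φ.symm x, fun i hi => ?_⟩
      simp only [Set.mem_insert_iff, Set.mem_singleton_iff, hv.eq_iff] at hi
      rcases hi with rfl | rfl | rfl <;> simp [R, hx]
    · obtain ⟨x, h₀, h₃, h₄⟩ := z₄ (s (ν 0)) (s (ν 3)) (s (ν 4))
      refine ⟨φ.symm x, fun i hi => ?_⟩
      simp only [Set.mem_insert_iff, Set.mem_singleton_iff, hv.eq_iff] at hi
      rcases hi with rfl | rfl | rfl <;> simp [R, h₀, h₃, h₄]
  · obtain ⟨i, rfl⟩ := hν.2 x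
    rw [hC]
    fin_cases i
    exacts [p₀₁.1, p₀₁.2.1, p₀₂.2.1, p₀₃.2.1, p₀₄.2.1]
  · obtain ⟨i, rfl⟩ := hν.2 x
    obtain ⟨k, rfl⟩ := hν.2 x'
    rw [hC, hC]
    have hik : i ≠ k := fun h => hxx' (congrArg ν h)
    rw [hE] at hEE
    change v i ∈ E at hx
    change v k ∈ E at hx'
    rcases hEE with rfl | rfl | rfl <;>
      simp only [Set.mem_insert_iff, Set.mem_singleton_iff, hv.eq_iff] at hx hx' <;>
      rcases hx with rfl | rfl | rfl <;> rcases hx' with rfl | rfl | rfl <;>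
      first
      | exact absurd rfl hik
      | assumption
      | exact IsPairwiseBalanced.symm (by assumption)
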